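/- Let $n\in\mathbb N$, let $\mathbb F_n^+$ be the unital free semigroup on generators $g_1,\dots,g_n$ with identity $g_0$, and let $F^2(H_n)$ be the full Fock space on $n$ generators, with its orthonormal basis $\{e_\alpha\}_{\alpha\in\mathbb F_n^+}$ and left creation operators $S_ie_\alpha=e_{g_i\alpha}$. For a tuple $X=(X_1,\dots,X_n)$ of operators and $\alpha=g_{i_1}\cdots g_{i_k}$ write $X_\alpha=X_{i_1}\cdots X_{i_k}$, with $X_{g_0}=I$. Let $g=1+\sum_{|\alpha|\ge1}b_\alpha Z_\alpha$ be a formal power series in noncommuting indeterminates $Z_1,\dots,Z_n$, let $g^{-1}=1+\sum_{|\alpha|\ge 1}a_\alpha Z_\alpha$ be its inverse with respect to the Cauchy product, and put $a_{g_0}=b_{g_0}=1$. Suppose that $g$ is admissible, i.e. (a) $b_\alpha>0$ for all $\alpha$, and $\sup_{\alpha}b_\alpha/b_{g_i\alpha}<\infty$ for each $i=1,\dots,n$; (b) $g$ is a free holomorphic function in a neighborhood of the origin: there is $\delta>0$ such that $\sum_{k\ge0}\sum_{|\alpha|=k}b_\alpha X_\alpha$ converges in norm for every Hilbert space $\mathcal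 H$ and every $X\in B(\mathcal H)^n$ with $\|X_1X_1^*+\dots+X_nX_n^*\|^{1/2}\le\delta$; (c) $\sup_N\big\|\sum_{k=0}^N\sum_{|\alpha|=k}a_\alpha W_\alpha W_\alpha^*\big\|<\infty$, where $W_1,\dots,W_n\in B(F^2(H_n))$ are the weighted left creation operators $W_ie_\alpha=\sqrt{b_\alpha/b_{g_i\alpha}}\;e_{g_i\alpha}$. Let $C^*(\mathbf W)$ be the C*-algebra generated by $W_1,\dots,W_n$ and the identity. A unital $*$-representation $\pi:C^*(\mathbf W)\to B(\mathcal K)$ is said to be of Cuntz type if $\sum_{k\ge0}\sum_{|\alpha|=k}a_\alpha\,\pi(W)_\alpha\,\pi(W)_\alpha^*=0$, where $\pi(W)=(\pi(W_1),\dots,\pi(W_n))$ and the series converges in the weak operator topology. Let $\mathcal O(g)$ be the universal C*-algebra generated by $\pi(W_1),\dots,\pi(W_n)$ and the identity, $\pi$ a Cuntz type representation; that is, $\mathcal O(g)$ is the C*-algebra generated by the identity and the elements $v_i=(\pi(W_i))_\pi$, $i=1,\dots,n$, of the $\ell^\infty$-product of the algebras $B(\mathcal K_\pi)$ over all Cuntz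 type representations $\pi:C^*(\mathbf W)\to B(\mathcal K_\pi)$ on nonzero Hilbert spaces. If the series $\sum_{k=0}^\infty\sum_{|\alpha|=k}a_\alpha W_\alpha W_\alpha^*$ converges in the operator norm, then the sequence of C*-algebras $$0\to\mathcal K(F^2(H_n))\to C^*(\mathbf W)\to\mathcal O(g)\to0$$ is exact, where $\mathcal K(F^2(H_n))$ is the ideal of compact operators. More precisely: all compact operators on $F^2(H_n)$ belong to $C^*(\mathbf W)$, and there is a surjective unital $*$-homomorphism $\rho:C^*(\mathbf W)\to\mathcal O(g)$ with $\rho(W_i)=v_i$ for $i=1,\dots,n$, whose kernel is $\mathcal K(F^2(H_n))$. -/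

import Mathlib

open Filter Topology
open scoped ENNReal

noncomputable section

namespace FockModel

/-! ### Noncommutative formal power series

A word `α` in the unital free semigroup on `n` generators is an element of `FreeMonoid (Fin n)`;
a formal power series `∑ c_α Z_α` is the function `α ↦ c_α`. -/

/-- The Cauchy product of two formal power series in noncommuting indeterminates:
its coefficient at `γ` is the sum of `f_α h_β` over all factorizations `γ = αβ`. -/
def seriesMul {σ : Type*} (f h : FreeMonoid σ → ℝ) (γ : FreeMonoid σ) : ℝ :=
  ∑ j ∈ Finset.range (γ.length + 1),
    f (FreeMonoid.ofList (γ.toList.take j)) * h (FreeMonoid.ofList (γ.toList.drop j))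

/-- The formal power series `1`. -/
def seriesOne {σ : Type*} (γ : FreeMonoid σ) : ℝ := if γ.length = 0 then 1 else 0

/-- The inverse `∑ a_α Z_α` of a formal power series `∑ b_α Z_α` with `b_1 = 1`: it has `a_1 = 1`
and `a_γ = -∑ a_α b_β`, the sum over the factorizations `γ = αβ` with `α ≠ γ`. -/
def seriesInv {σ : Type*} (b : FreeMonoid σ → ℝ) (γ : FreeMonoid σ) : ℝ :=
  if γ.length = 0 then 1
  else -∑ j : Fin γ.length,
    seriesInv b (FreeMonoid.ofList (γ.toList.take j)) *
      b (FreeMonoid.ofList (γ.toList.drop j))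
termination_by γ.length
decreasing_by
  have h := j.2
  simp only [FreeMonoid.length, FreeMonoid.toList_ofList, List.length_take] at h ⊢
  omega

/-- `seriesInv b` is a left inverse of `b`. -/
theorem seriesMul_seriesInv_left {σ : Type*} (b : FreeMonoid σ → ℝ)
    (hb : b 1 = 1) : seriesMul (seriesInv b) b = seriesOne := by
  funext γ
  by_cases hγ : γ = 1
  · subst hγ
    have h1 : seriesInv b 1 = 1 := by rw [seriesInv]; simp
    simp [seriesMul, seriesOne, h1, hb]
  · have hl : γ.length ≠ 0 := by simpa [FreeMonoid.length_eq_zero] using hγ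
    have h2 : seriesInv b γ = -∑ j : Fin γ.length,
        seriesInv b (FreeMonoid.ofList (γ.toList.take j)) *
          b (FreeMonoid.ofList (γ.toList.drop j)) := by
      conv_lhs => rw [seriesInv]
      rw [if_neg hl]
    rw [seriesMul, Finset.sum_range_succ, Finset.sum_range, seriesOne, if_neg hl]
    have h3 : γ.toList.take γ.length = γ.toList := List.take_length
    have h4 : γ.toList.drop γ.length = [] := List.drop_length
    rw [h3, h4, FreeMonoid.ofList_toList, FreeMonoid.ofList_nil, hb, mul_one, h2, add_neg_cancel]

theorem seriesMul_cons {σ : Type*} (f h : FreeMonoid σ → ℝ) (x : σ) (w : List σ) :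
    seriesMul f h (FreeMonoid.ofList (x :: w)) =
      f 1 * h (FreeMonoid.ofList (x :: w)) +
        seriesMul (fun v ↦ f (FreeMonoid.of x * v)) h (FreeMonoid.ofList w) := by
  have hlen : (FreeMonoid.ofList (x :: w)).length = w.length + 1 := rfl
  have hlen' : (FreeMonoid.ofList w).length = w.length := rfl
  rw [seriesMul, seriesMul, hlen, hlen', Finset.sum_range_succ']
  rw [add_comm]
  rfl

theorem seriesMul_assoc {σ : Type*} (f h k : FreeMonoid σ → ℝ) :
    seriesMul (seriesMul f h) k = seriesMul f (seriesMul h k) := by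
  funext γ
  suffices H : ∀ (w : List σ) (f : FreeMonoid σ → ℝ),
      seriesMul (seriesMul f h) k (FreeMonoid.ofList w) =
        seriesMul f (seriesMul h k) (FreeMonoid.ofList w) from H γ.toList f
  intro w
  induction w with
  | nil =>
    intro f
    simp [seriesMul, mul_assoc]
  | cons x w ih =>
    intro f
    have hlin : seriesMul (fun v ↦ seriesMul f h (FreeMonoid.of x * v)) k
        (FreeMonoid.ofList w) =
        f 1 * seriesMul (fun v ↦ h (FreeMonoid.of x * v)) k (FreeMonoid.ofList w) +
          seriesMul (seriesMul (fun v ↦ f (FreeMonoid.of x * v)) h) k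
            (FreeMonoid.ofList w) := by
      have e : ∀ v, seriesMul f h (FreeMonoid.of x * v) =
          f 1 * h (FreeMonoid.of x * v) +
            seriesMul (fun v ↦ f (FreeMonoid.of x * v)) h v :=
        fun v ↦ seriesMul_cons f h x v.toList
      simp only [e]
      simp only [seriesMul, add_mul, Finset.sum_add_distrib, Finset.mul_sum, mul_assoc]
    have h1 : seriesMul f h 1 = f 1 * h 1 := by simp [seriesMul]
    rw [seriesMul_cons, seriesMul_cons, seriesMul_cons h k, hlin, ih, h1]
    ring

theorem seriesOne_mul {σ : Type*} (f : FreeMonoid σ → ℝ) :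
    seriesMul seriesOne f = f := by
  funext γ
  rw [seriesMul, Finset.sum_eq_single 0]
  · simp [seriesOne]
  · intro j hj hj0
    have : FreeMonoid.ofList (γ.toList.take j) ≠ 1 := by
      intro h
      have h' := congrArg FreeMonoid.length h
      simp only [FreeMonoid.length, FreeMonoid.toList_ofList, List.length_take,
        FreeMonoid.toList_one, List.length_nil, Finset.mem_range] at h' hj
      omega
    simp [seriesOne, FreeMonoid.length_eq_zero, this]
  · simp

theorem seriesMul_one {σ : Type*} (f : FreeMonoid σ → ℝ) :
    seriesMul f seriesOne = f := by
  funext γ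
  rw [seriesMul, Finset.sum_eq_single γ.length]
  · have h3 : γ.toList.take γ.length = γ.toList := List.take_length
    have h4 : γ.toList.drop γ.length = [] := List.drop_length
    rw [h3, h4]
    simp [seriesOne]
  · intro j hj hj0
    have : FreeMonoid.ofList (γ.toList.drop j) ≠ 1 := by
      intro h
      have h' := congrArg FreeMonoid.length h
      simp only [FreeMonoid.length, FreeMonoid.toList_ofList, List.length_drop,
        FreeMonoid.toList_one, List.length_nil, Finset.mem_range] at h' hj hj0
      omega
    simp [seriesOne, FreeMonoid.length_eq_zero, this]
  · simp

theorem seriesInv_one {σ : Type*} (b : FreeMonoid σ → ℝ) : seriesInv b 1 = 1 := by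
  rw [seriesInv]; simp

/-- `seriesInv b` is also a right inverse of `b`, so it is the inverse of `b`. -/
theorem seriesMul_seriesInv_right {σ : Type*} (b : FreeMonoid σ → ℝ)
    (hb : b 1 = 1) : seriesMul b (seriesInv b) = seriesOne := by
  have h1 := seriesMul_seriesInv_left b hb
  have h2 := seriesMul_seriesInv_left (seriesInv b) (seriesInv_one b)
  calc seriesMul b (seriesInv b)
      = seriesMul seriesOne (seriesMul b (seriesInv b)) := (seriesOne_mul _).symm
    _ = seriesMul (seriesMul (seriesInv (seriesInv b)) (seriesInv b))
          (seriesMul b (seriesInv b)) := by rw [h2]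
    _ = seriesMul (seriesInv (seriesInv b))
          (seriesMul (seriesMul (seriesInv b) b) (seriesInv b)) := by
        simp only [seriesMul_assoc]
    _ = seriesOne := by rw [h1, seriesOne_mul, h2]

/-! ### Operator tuples -/

/-- `X_α = X_{i₁} ⋯ X_{iₖ}` for the word `α = g_{i₁} ⋯ g_{iₖ}`, and `X_1 = 1`. -/
def word {n : ℕ} {A : Type*} [Monoid A] (X : Fin n → A) (α : FreeMonoid (Fin n)) : A :=
  FreeMonoid.lift X α

/-- The partial sum `∑_{k < N} ∑_{|α| = k} F_α`. -/
def gradedSum {n : ℕ} {A : Type*} [AddCommMonoid A] (F : FreeMonoid (Fin n) → A) (N : ℕ) : A :=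
  ∑ k ∈ Finset.range N, ∑ w : Fin k → Fin n, F (FreeMonoid.ofList (List.ofFn w))

/-- The formal power series `∑ c_α Z_α` is a free holomorphic function in a neighborhood of the
origin: for some `δ > 0`, the series `∑_k ∑_{|α| = k} c_α X_α` converges in norm for every
tuple `X` of operators on a Hilbert space with `‖∑ X_i X_i^*‖^{1/2} ≤ δ`. -/
def IsFreeHolomorphic {n : ℕ} (c : FreeMonoid (Fin n) → ℂ) : Prop :=
  ∃ δ : ℝ, 0 < δ ∧
    ∀ (H : Type) [NormedAddCommGroup H] [InnerProductSpace ℂ H] [CompleteSpace H]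
      (X : Fin n → H →L[ℂ] H), √‖∑ i, X i * star (X i)‖ ≤ δ →
      ∃ Y : H →L[ℂ] H, Tendsto (gradedSum fun α ↦ c α • word X α) atTop (𝓝 Y)

/-- The partial sums `∑_{k < N} ∑_{|α| = k} a_α X_α X_α^*`. -/
def deltaSum {n : ℕ} {A : Type*} [Ring A] [StarRing A] [Module ℂ A]
    (a : FreeMonoid (Fin n) → ℝ) (X : Fin n → A) : ℕ → A :=
  gradedSum fun α ↦ (a α : ℂ) • (word X α * star (word X α))

/-! ### The full Fock space and its weighted left creation operators -/

/-- The full Fock space on `n` generators, with its orthonormal basis `e_α` indexed by words. -/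
abbrev Fock (n : ℕ) : Type := lp (fun _ : FreeMonoid (Fin n) ↦ ℂ) 2

instance (n : ℕ) : DecidableEq (FreeMonoid (Fin n)) := inferInstanceAs (DecidableEq (List (Fin n)))

/-- The basis vector `e_α = e_{i₁} ⊗ ⋯ ⊗ e_{iₖ}`. -/
def fockBasis {n : ℕ} (α : FreeMonoid (Fin n)) : Fock n := lp.single 2 α (1 : ℂ)

theorem orthonormal_fockBasis (n : ℕ) : Orthonormal ℂ (fockBasis (n := n)) := by
  rw [orthonormal_iff_ite]
  intro α β
  simp [fockBasis, lp.inner_single_left, Pi.single_apply]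

theorem orthonormal_fockBasis_of_mul {n : ℕ} (i : Fin n) :
    Orthonormal ℂ fun α : FreeMonoid (Fin n) ↦ fockBasis (FreeMonoid.of i * α) :=
  (orthonormal_fockBasis n).comp _ fun _ _ h ↦ mul_left_cancel h

/-- The left creation operator `S_i`, `S_i φ = e_i ⊗ φ`, i.e. `S_i e_α = e_{g_i α}`. -/
def leftCreation {n : ℕ} (i : Fin n) : Fock n →L[ℂ] Fock n :=
  (orthonormal_fockBasis_of_mul i).orthogonalFamily.linearIsometry.toContinuousLinearMap

theorem leftCreation_fockBasis {n : ℕ} (i : Fin n) (α : FreeMonoid (Fin n)) :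
    leftCreation i (fockBasis α) = fockBasis (FreeMonoid.of i * α) := by
  simp [leftCreation, fockBasis]

/-- The diagonal operator `e_α ↦ d_α e_α` with bounded diagonal entries. -/
def diagonalOp {n : ℕ} (d : FreeMonoid (Fin n) → ℝ) (hd : ∃ C : ℝ, 0 ≤ C ∧ ∀ α, |d α| ≤ C) :
    Fock n →L[ℂ] Fock n :=
  lp.mapCLM 2 (fun α ↦ (d α : ℂ) • ContinuousLinearMap.id ℂ ℂ) hd.choose_spec.1 fun α ↦ by
    simpa [norm_smul] using hd.choose_spec.2 α

theorem diagonalOp_fockBasis {n : ℕ} (d : FreeMonoid (Fin n) → ℝ)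
    (hd : ∃ C : ℝ, 0 ≤ C ∧ ∀ α, |d α| ≤ C) (α : FreeMonoid (Fin n)) :
    diagonalOp d hd (fockBasis α) = (d α : ℂ) • fockBasis α := by
  ext β
  by_cases h : β = α
  · subst h
    rw [lp.coeFn_smul]
    simp [diagonalOp, fockBasis]
  · rw [lp.coeFn_smul]
    simp [diagonalOp, fockBasis, h]

/-- A collection of strictly positive weights `b_α`, `α` a word in `n` letters, with `b_1 = 1` and
`sup_α b_α / b_{g_i α} < ∞` for every `i`. It is identified with the power series
`g = 1 + ∑_{|α| ≥ 1} b_α Z_α`. -/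
structure Weights (n : ℕ) where
  b : FreeMonoid (Fin n) → ℝ
  pos : ∀ α, 0 < b α
  one : b 1 = 1
  bddAbove : ∀ i, BddAbove (Set.range fun α ↦ b α / b (FreeMonoid.of i * α))

namespace Weights

variable {n : ℕ} (g : Weights n)

theorem diagonal_bound (i : Fin n) :
    ∃ C : ℝ, 0 ≤ C ∧ ∀ α, |√(g.b α / g.b (FreeMonoid.of i * α))| ≤ C := by
  obtain ⟨M, hM⟩ := g.bddAbove i
  refine ⟨√M, Real.sqrt_nonneg _, fun α ↦ ?_⟩
  rw [abs_of_nonneg (Real.sqrt_nonneg _)]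
  exact Real.sqrt_le_sqrt (hM ⟨α, rfl⟩)

/-- The weighted left creation operators `W_i = S_i D_i` associated with `g`, where
`D_i e_α = √(b_α / b_{g_i α}) e_α`. -/
def W (i : Fin n) : Fock n →L[ℂ] Fock n :=
  leftCreation i ∘L diagonalOp (fun α ↦ √(g.b α / g.b (FreeMonoid.of i * α))) (g.diagonal_bound i)

theorem W_fockBasis (i : Fin n) (α : FreeMonoid (Fin n)) :
    g.W i (fockBasis α) =
      (√(g.b α / g.b (FreeMonoid.of i * α)) : ℂ) • fockBasis (FreeMonoid.of i * α) := by
  rw [W, ContinuousLinearMap.comp_apply, diagonalOp_fockBasis, map_smul, leftCreation_fockBasis]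

/-- The coefficients `a_α` of the inverse power series `g⁻¹ = 1 + ∑_{|α| ≥ 1} a_α Z_α`. -/
def a : FreeMonoid (Fin n) → ℝ := seriesInv g.b

/-- `g` is admissible: it is a free holomorphic function in a neighborhood of the origin, and the
partial sums of `∑_k ∑_{|α| = k} a_α W_α W_α^*` are bounded in norm. -/
structure IsAdmissible : Prop where
  freeHolomorphic : IsFreeHolomorphic fun α ↦ (g.b α : ℂ)
  bounded : BddAbove (Set.range fun N ↦ ‖deltaSum g.a g.W N‖)

/-- The C*-algebra `C*(W)` generated by `W_1, …, W_n` and the identity. -/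
def cstarW : StarSubalgebra ℂ (Fock n →L[ℂ] Fock n) :=
  (StarAlgebra.adjoin ℂ (Set.range g.W)).topologicalClosure

instance : IsClosed (g.cstarW : Set (Fock n →L[ℂ] Fock n)) :=
  StarSubalgebra.isClosed_topologicalClosure _

instance : CStarAlgebra g.cstarW := StarSubalgebra.cstarAlgebra g.cstarW

/-- `W_i` as an element of `C*(W)`. -/
def genW (i : Fin n) : g.cstarW :=
  ⟨g.W i, StarSubalgebra.le_topologicalClosure _ (StarAlgebra.subset_adjoin ℂ _ ⟨i, rfl⟩)⟩

/-- A unital `*`-representation `π` of `C*(W)` is of Cuntz type if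
`∑_k ∑_{|α| = k} a_α π(W)_α π(W)_α^* = 0` (in the weak operator topology). -/
def IsCuntzType {K : Type*} [NormedAddCommGroup K] [InnerProductSpace ℂ K] [CompleteSpace K]
    (π : g.cstarW →⋆ₐ[ℂ] (K →L[ℂ] K)) : Prop :=
  ∀ ξ η : K, Tendsto (fun N ↦ inner ℂ ξ (deltaSum g.a (fun i ↦ π (g.genW i)) N η)) atTop (𝓝 0)

/-- The Cuntz type representations of `C*(W)` on nonzero Hilbert spaces. -/
structure CuntzRep where
  K : Type
  [normedAddCommGroup : NormedAddCommGroup K]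
  [innerProductSpace : InnerProductSpace ℂ K]
  [completeSpace : CompleteSpace K]
  [nontrivial : Nontrivial K]
  π : g.cstarW →⋆ₐ[ℂ] (K →L[ℂ] K)
  isCuntzType : g.IsCuntzType π

attribute [instance] CuntzRep.normedAddCommGroup CuntzRep.innerProductSpace
  CuntzRep.completeSpace CuntzRep.nontrivial

/-- The `ℓ^∞`-product of the C*-algebras `B(K_ω)`, `ω` ranging over all Cuntz type
representations. -/
abbrev CuntzProduct : Type 1 := lp (fun ω : g.CuntzRep ↦ ω.K →L[ℂ] ω.K) ∞

instance : CStarAlgebra g.CuntzProduct where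

/-- The universal generators `v_i = (π_ω(W_i))_ω`. -/
def universalGen (i : Fin n) : g.CuntzProduct :=
  ⟨fun ω ↦ ω.π (g.genW i), memℓp_infty ⟨‖g.genW i‖, by
    rintro _ ⟨ω, rfl⟩
    exact NonUnitalStarAlgHom.norm_apply_le ω.π (g.genW i)⟩⟩

/-- `𝒪(g)`, the universal C*-algebra generated by `π(W_1), …, π(W_n)` and the identity, `π` a Cuntz
type representation of `C*(W)`: it is generated by `v_1, …, v_n` and the identity, so that
`‖q(v, v^*)‖ = sup_π ‖q(π(W), π(W)^*)‖` for every noncommutative polynomial `q`. -/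
def cuntzAlgebra : StarSubalgebra ℂ g.CuntzProduct :=
  (StarAlgebra.adjoin ℂ (Set.range g.universalGen)).topologicalClosure

instance : IsClosed (g.cuntzAlgebra : Set g.CuntzProduct) :=
  StarSubalgebra.isClosed_topologicalClosure _

instance : CStarAlgebra g.cuntzAlgebra := StarSubalgebra.cstarAlgebra g.cuntzAlgebra

/-- The generators of `𝒪(g)`. -/
def cuntzGen (i : Fin n) : g.cuntzAlgebra :=
  ⟨g.universalGen i,
    StarSubalgebra.le_topologicalClosure _ (StarAlgebra.subset_adjoin ℂ _ ⟨i, rfl⟩)⟩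

/-- The universal property of `𝒪(g)`: every Cuntz type representation of `C*(W)` induces a unique
unital `*`-homomorphism on `𝒪(g)` that maps the generators to the `π(W_i)`. -/
theorem existsUnique_cuntzAlgebra_hom (ω : g.CuntzRep) :
    ∃! φ : g.cuntzAlgebra →⋆ₐ[ℂ] (ω.K →L[ℂ] ω.K),
      ∀ i, φ (g.cuntzGen i) = ω.π (g.genW i) := by
  let ev : g.CuntzProduct →⋆ₐ[ℂ] (ω.K →L[ℂ] ω.K) :=
    { toFun := fun x ↦ x ω
      map_one' := by simp
      map_mul' := fun x y ↦ by rw [lp.infty_coeFn_mul]; rfl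
      map_zero' := rfl
      map_add' := fun x y ↦ rfl
      commutes' := fun r ↦ rfl
      map_star' := fun x ↦ rfl }
  refine ⟨ev.comp g.cuntzAlgebra.subtype, fun i ↦ rfl, fun ψ hψ ↦ ?_⟩
  have hcont : ∀ χ : g.cuntzAlgebra →⋆ₐ[ℂ] (ω.K →L[ℂ] ω.K), Continuous χ := fun χ ↦
    AddMonoidHomClass.continuous_of_bound χ 1 fun x ↦ by
      simpa using NonUnitalStarAlgHom.norm_apply_le χ x
  refine StarAlgHom.ext_topologicalClosure (hcont ψ) (hcont _) ?_
  refine StarAlgHom.ext_adjoin ?_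
  rintro ⟨_, hx⟩ ⟨i, rfl⟩
  exact hψ i

end Weights

/-! ### Compact operators -/

theorem isCompactOperator_star {H : Type*} [NormedAddCommGroup H] [InnerProductSpace ℂ H]
    [CompleteSpace H] {T : H →L[ℂ] H} (hT : IsCompactOperator T) :
    IsCompactOperator (star T : H →L[ℂ] H) := by
  have hTT : TotallyBounded ((T ∘L star T) '' Metric.closedBall 0 1) :=
    ((hT.comp_clm (star T)).isCompact_closure_image_closedBall
      (f := ((T ∘L star T : H →L[ℂ] H) : H →ₗ[ℂ] H)) 1).totallyBounded.subset subset_closure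
  have key : TotallyBounded ((star T : H →L[ℂ] H) '' Metric.closedBall 0 1) := by
    rw [Metric.totallyBounded_iff]
    intro ε hε
    obtain ⟨t, hts, htf, hcov⟩ := Metric.finite_approx_of_totallyBounded hTT (ε ^ 2 / 2)
      (by positivity)
    obtain ⟨u, hus, huf, rfl⟩ := Set.exists_subset_image_finite_and.mp ⟨t, hts, htf, rfl⟩
    refine ⟨(star T : H →L[ℂ] H) '' u, huf.image _, ?_⟩
    rintro _ ⟨x, hx, rfl⟩
    obtain ⟨_, ⟨y, hy, rfl⟩, hxy⟩ := Set.mem_iUnion₂.mp (hcov ⟨x, hx, rfl⟩)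
    refine Set.mem_iUnion₂.mpr ⟨_, ⟨y, hy, rfl⟩, ?_⟩
    have hxn : ‖x‖ ≤ 1 := by simpa using hx
    have hyn : ‖y‖ ≤ 1 := by simpa using hus hy
    have h1 : ‖T ((star T : H →L[ℂ] H) (x - y))‖ < ε ^ 2 / 2 := by
      rw [map_sub, map_sub, ← dist_eq_norm]
      exact hxy
    have h2 : ‖(star T : H →L[ℂ] H) (x - y)‖ ^ 2 ≤
        ‖T ((star T : H →L[ℂ] H) (x - y))‖ * ‖x - y‖ := by
      have h3 : inner ℂ ((star T : H →L[ℂ] H) (x - y)) ((star T : H →L[ℂ] H) (x - y)) =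
          inner ℂ (T ((star T : H →L[ℂ] H) (x - y))) (x - y) := by
        rw [ContinuousLinearMap.star_eq_adjoint, ContinuousLinearMap.adjoint_inner_right]
      rw [← inner_self_eq_norm_sq (𝕜 := ℂ), h3]
      exact (RCLike.re_le_norm _).trans (norm_inner_le_norm _ _)
    have h4 : ‖x - y‖ ≤ 2 := (norm_sub_le x y).trans (by linarith)
    rw [Metric.mem_ball, dist_eq_norm, ← map_sub]
    refine lt_of_pow_lt_pow_left₀ 2 hε.le (h2.trans_lt ?_)
    nlinarith [norm_nonneg (T ((star T : H →L[ℂ] H) (x - y))), norm_nonneg (x - y)]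
  exact (isCompactOperator_iff_isCompact_closure_image_closedBall
    ((star T : H →L[ℂ] H) : H →ₗ[ℂ] H) one_pos).2
      (isCompact_iff_totallyBounded_isComplete.2 ⟨key.closure, isClosed_closure.isComplete⟩)

/-- The C*-algebra of compact operators on a Hilbert space. -/
def compactOps (H : Type*) [NormedAddCommGroup H] [InnerProductSpace ℂ H] [CompleteSpace H] :
    NonUnitalStarSubalgebra ℂ (H →L[ℂ] H) where
  carrier := {T | IsCompactOperator T}
  add_mem' hS hT := hS.add hT
  zero_mem' := isCompactOperator_zero
  mul_mem' {_ T} hS _ := hS.comp_clm T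
  smul_mem' c _ hT := hT.smul c
  star_mem' hT := isCompactOperator_star hT

instance (H : Type*) [NormedAddCommGroup H] [InnerProductSpace ℂ H] [CompleteSpace H] :
    IsClosed (compactOps H : Set (H →L[ℂ] H)) :=
  isClosed_setOfPred_isCompactOperator

instance (H : Type*) [NormedAddCommGroup H] [InnerProductSpace ℂ H] [CompleteSpace H] :
    NonUnitalCStarAlgebra (compactOps H) :=
  NonUnitalStarSubalgebra.nonUnitalCStarAlgebra (compactOps H)

end FockModel

end

open FockModel

/-! On a basis vector `e_γ` the sums `∑ a_α W_α W_α^*` stabilise once all prefixes of `γ` have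
occurred, and the value is the coefficient of `γ` in `g⁻¹ g = 1`, divided by `b_γ`, times `e_γ`. So
the norm limit can only be the vacuum projection `P`, which therefore lies in `C*(W)`. Up to nonzero
scalars the operators `W_α P W_β^*` are the matrix units of the Fock basis, so `C*(W)` contains all
compact operators. A representation is of Cuntz type exactly when it kills `P`, and then it kills
every compact operator.

Let `σ` be the direct sum of all Cuntz type representations (`cuntzDiagonal`). It remains to see
that `σ` kills nothing else and that its range is closed. Both follow from one estimate,
`exists_norm_sub_comp_coordProj_le`: for every `c > ‖σ x‖` some finite truncation satisfies `‖x - x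
P_J‖ ≤ c`. Otherwise there are unit vectors `ξ_J` orthogonal to the range of `P_J` with `‖x ξ_J‖ ≥
c`. A limit of their vector states along an ultrafilter is a state vanishing on compact operators
and at least `c²` at `x^* x`; its GNS representation is of Cuntz type and gives `x` norm at least
`c`, a contradiction.

If `σ x = 0`, the estimate makes `x` a norm limit of compact operators. In general `x - x P_J` is a
lift of `σ x` of controlled norm, so the range of `σ` is closed. Containing the generators, it
contains `𝒪(g)`. -/

open Filter Topology InnerProductSpace
open scoped ENNReal ComplexOrder

/-! ### Compact operators and truncations along a Hilbert basis -/

namespace HilbertBasis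

variable {ι H : Type*} [NormedAddCommGroup H] [InnerProductSpace ℂ H]

/-- The orthogonal projection onto the span of finitely many vectors of a Hilbert basis. -/
noncomputable def coordProj (b : HilbertBasis ι ℂ H) (J : Finset ι) : H →L[ℂ] H :=
  ∑ i ∈ J, rankOne ℂ (b i) (b i)

variable (b : HilbertBasis ι ℂ H)

theorem coordProj_apply (J : Finset ι) (x : H) :
    b.coordProj J x = ∑ i ∈ J, inner ℂ (b i) x • b i := by
  simp [coordProj]

theorem coordProj_comp_self (J : Finset ι) : b.coordProj J ∘L b.coordProj J = b.coordProj J := by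
  ext x
  rw [ContinuousLinearMap.comp_apply, coordProj_apply b J (b.coordProj J x), coordProj_apply]
  refine Finset.sum_congr rfl fun i hi ↦ ?_
  rw [b.orthonormal.inner_right_sum _ hi]

theorem tendsto_coordProj (x : H) : Tendsto (fun J ↦ b.coordProj J x) atTop (𝓝 x) := by
  have h := b.hasSum_repr x
  simp only [b.repr_apply_apply] at h
  simpa only [HasSum, SummationFilter.unconditional_filter, ← coordProj_apply] using h

theorem comp_coordProj (T : H →L[ℂ] H) (J : Finset ι) :
    T ∘L b.coordProj J = ∑ i ∈ J, rankOne ℂ (T (b i)) (b i) := by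
  ext x
  simp [coordProj_apply]

theorem _root_.InnerProductSpace.isCompactOperator_rankOne (x y : H) :
    IsCompactOperator (rankOne ℂ x y) := by
  rw [rankOne_def', ContinuousLinearMap.coe_comp]
  exact (isCompactOperator_of_locallyCompactSpace_rng
    (ContinuousLinearMap.toSpanSingleton ℂ x)).comp_clm (innerSL ℂ y)

theorem isCompactOperator_comp_coordProj [CompleteSpace H] (T : H →L[ℂ] H) (J : Finset ι) :
    IsCompactOperator (T ∘L b.coordProj J) := by
  rw [comp_coordProj]
  exact sum_mem (S := compactOps H) fun i _ ↦ isCompactOperator_rankOne _ _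

variable [CompleteSpace H]

theorem star_coordProj (J : Finset ι) : star (b.coordProj J) = b.coordProj J := by
  simp [coordProj, ContinuousLinearMap.star_eq_adjoint]

theorem isStarProjection_coordProj (J : Finset ι) : IsStarProjection (b.coordProj J) :=
  ⟨b.coordProj_comp_self J, b.star_coordProj J⟩

theorem norm_one_sub_coordProj_le (J : Finset ι) : ‖1 - b.coordProj J‖ ≤ 1 :=
  (b.isStarProjection_coordProj J).one_sub.norm_le

/-- The contractions `1 - P_J` tend to zero pointwise, hence uniformly on the totally bounded image
of the unit ball: it suffices to treat a finite net. -/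
theorem tendsto_norm_one_sub_coordProj_mul {T : H →L[ℂ] H} (hT : IsCompactOperator T) :
    Tendsto (fun J ↦ ‖(1 - b.coordProj J) * T‖) atTop (𝓝 0) := by
  have hTB : TotallyBounded (T '' Metric.closedBall 0 1) :=
    (hT.isCompact_closure_image_closedBall (f := (T : H →ₗ[ℂ] H))
      1).totallyBounded.subset subset_closure
  rw [Metric.tendsto_nhds]
  intro ε hε
  obtain ⟨t, htf, hcov⟩ := Metric.totallyBounded_iff.mp hTB (ε / 3) (by positivity)
  have hev : ∀ᶠ J in atTop, ∀ y ∈ t, ‖y - b.coordProj J y‖ < ε / 3 := by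
    rw [Set.Finite.eventually_all htf]
    intro y _
    have h := (Metric.tendsto_nhds.mp (b.tendsto_coordProj y)) (ε / 3) (by positivity)
    filter_upwards [h] with J hJ
    rwa [dist_comm, dist_eq_norm] at hJ
  filter_upwards [hev] with J hJ
  rw [dist_zero_right, norm_norm]
  refine lt_of_le_of_lt (ContinuousLinearMap.opNorm_le_of_unit_norm (C := 2 * (ε / 3))
    (by positivity) fun x hx ↦ ?_) (by linarith)
  obtain ⟨y, hy, hxy⟩ := Set.mem_iUnion₂.mp (hcov ⟨x, by simp [hx], rfl⟩)
  rw [Metric.mem_ball, dist_eq_norm] at hxy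
  calc ‖((1 - b.coordProj J) * T) x‖
      = ‖(1 - b.coordProj J) (T x - y) + (y - b.coordProj J y)‖ := by
        congr 1
        change T x - b.coordProj J (T x) =
          T x - y - b.coordProj J (T x - y) + (y - b.coordProj J y)
        rw [map_sub]
        abel
    _ ≤ ‖T x - y‖ + ‖y - b.coordProj J y‖ := by
        refine (norm_add_le _ _).trans (add_le_add_left ?_ _)
        refine ((1 - b.coordProj J).le_opNorm _).trans ?_
        exact mul_le_of_le_one_left (norm_nonneg _) (b.norm_one_sub_coordProj_le J)
    _ ≤ 2 * (ε / 3) := by linarith [hJ y hy]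

/-- Taking adjoints turns `T - T P_J` into `(1 - P_J) T^*`, and `T^*` is compact as well. -/
theorem tendsto_norm_sub_comp_coordProj {T : H →L[ℂ] H} (hT : IsCompactOperator T) :
    Tendsto (fun J ↦ ‖T - T ∘L b.coordProj J‖) atTop (𝓝 0) := by
  refine (b.tendsto_norm_one_sub_coordProj_mul (isCompactOperator_star hT)).congr fun J ↦ ?_
  rw [← norm_star, star_mul, star_star, star_sub, star_one, star_coordProj, mul_sub, mul_one]
  rfl

theorem isCompactOperator_of_norm_sub_comp_coordProj_le {T : H →L[ℂ] H}
    (hT : ∀ ε > 0, ∃ J, ‖T - T ∘L b.coordProj J‖ ≤ ε) : IsCompactOperator T := by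
  have h : T ∈ closure (compactOps H : Set (H →L[ℂ] H)) := by
    rw [Metric.mem_closure_iff]
    intro ε hε
    obtain ⟨J, hJ⟩ := hT (ε / 2) (by positivity)
    exact ⟨_, b.isCompactOperator_comp_coordProj T J, by rw [dist_eq_norm]; linarith⟩
  rwa [IsClosed.closure_eq (inferInstance : IsClosed (compactOps H : Set (H →L[ℂ] H)))] at h

/-- A closed subspace of `B(H)` that contains the matrix units of a Hilbert basis contains all
compact operators. -/
theorem mem_of_isCompactOperator {I : Submodule ℂ (H →L[ℂ] H)}
    (hI : IsClosed (I : Set (H →L[ℂ] H))) (hb : ∀ i j, rankOne ℂ (b i) (b j) ∈ I)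
    {T : H →L[ℂ] H} (hT : IsCompactOperator T) : T ∈ I := by
  -- The left vector is freed first, by linearity and density; the truncations `T P_J` are then
  -- finite sums of such operators.
  have hx : ∀ (x : H) (j : ι), rankOne ℂ x (b j) ∈ I := by
    intro x j
    let L : H →L[ℂ] (H →L[ℂ] H) := (rankOne ℂ (E := H)).flip (b j)
    have hle : (Submodule.span ℂ (Set.range b)).topologicalClosure ≤ I.comap L.toLinearMap := by
      refine Submodule.topologicalClosure_minimal _ ?_ (hI.preimage L.continuous)
      rw [Submodule.span_le]
      rintro _ ⟨i, rfl⟩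
      exact hb i j
    rw [b.dense_span] at hle
    exact hle (Submodule.mem_top (x := x))
  have h := b.tendsto_norm_sub_comp_coordProj hT
  simp_rw [norm_sub_rev T] at h
  refine hI.mem_of_tendsto (tendsto_iff_norm_sub_tendsto_zero.mpr h)
    (Eventually.of_forall fun J ↦ ?_)
  rw [comp_coordProj]
  exact sum_mem fun i _ ↦ hx _ _

/-- If the distances from `T` to its truncations stay above `c`, then `T` is bounded below by `c`
on unit vectors orthogonal to any finite part of the basis. -/
theorem exists_unit_vector_of_lt_norm_sub {T : H →L[ℂ] H} {c : ℝ} (hc : 0 ≤ c) {J : Finset ι}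
    (h : c < ‖T - T ∘L b.coordProj J‖) : ∃ ξ : H, ‖ξ‖ = 1 ∧ b.coordProj J ξ = 0 ∧ c ≤ ‖T ξ‖ := by
  obtain ⟨x, hx⟩ : ∃ x, c * ‖x‖ < ‖(T - T ∘L b.coordProj J) x‖ := by
    by_contra! h'
    exact h.not_ge (ContinuousLinearMap.opNorm_le_bound _ hc h')
  -- Projecting away from the truncation leaves the value `T η` unchanged and does not increase the
  -- norm, so normalising `η` keeps the lower bound.
  set η := (1 - b.coordProj J) x with hη
  have hTη : (T - T ∘L b.coordProj J) x = T η := by simp [hη]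
  have hηx : ‖η‖ ≤ ‖x‖ := ((1 - b.coordProj J).le_opNorm x).trans
    (mul_le_of_le_one_left (norm_nonneg _) (b.norm_one_sub_coordProj_le J))
  rw [hTη] at hx
  have hη0 : 0 < ‖η‖ := by
    rw [norm_pos_iff]
    intro h0
    rw [h0, map_zero, norm_zero] at hx
    exact hx.not_ge (by positivity)
  have hP : b.coordProj J η = 0 := by
    have := congrArg (· x) (b.coordProj_comp_self J)
    simp only [ContinuousLinearMap.comp_apply] at this
    simp [hη, this]
  refine ⟨(‖η‖⁻¹ : ℂ) • η, ?_, ?_, ?_⟩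
  · rw [norm_smul, norm_inv, Complex.norm_real, norm_norm, inv_mul_cancel₀ hη0.ne']
  · rw [map_smul, hP, smul_zero]
  · rw [map_smul, norm_smul, norm_inv, Complex.norm_real, norm_norm, le_inv_mul_iff₀ hη0, mul_comm]
    exact (mul_le_mul_of_nonneg_left hηx hc).trans hx.le

end HilbertBasis

/-! ### The GNS representation of a state -/

namespace PositiveLinearMap

variable {A : Type*} [CStarAlgebra A] [PartialOrder A] [StarOrderedRing A] (f : A →ₚ[ℂ] ℂ)

/-- The cyclic vector of the GNS representation. -/
noncomputable def gnsVector : f.GNS := ((f.toPreGNS 1 : f.PreGNS) : f.GNS)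

theorem norm_gnsStarAlgHom_gnsVector_sq (a : A) :
    ((‖f.gnsStarAlgHom a f.gnsVector‖ ^ 2 : ℝ) : ℂ) = f (star a * a) := by
  have h : f.gnsStarAlgHom a f.gnsVector = ((f.toPreGNS a : f.PreGNS) : f.GNS) := by
    change f.gnsNonUnitalStarAlgHom a _ = _
    simp [gnsVector]
  rw [h, UniformSpace.Completion.norm_coe]
  push_cast
  rw [preGNS_norm_sq, ofPreGNS_toPreGNS]

theorem norm_gnsVector_sq : ((‖f.gnsVector‖ ^ 2 : ℝ) : ℂ) = f 1 := by
  simpa using f.norm_gnsStarAlgHom_gnsVector_sq 1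

variable {f} in
theorem norm_gnsVector (hf : f 1 = 1) : ‖f.gnsVector‖ = 1 := by
  have h1 := f.norm_gnsVector_sq
  rw [hf, Complex.ofReal_eq_one] at h1
  exact (pow_eq_one_iff_of_nonneg (norm_nonneg _) two_ne_zero).mp h1

variable {f} in
theorem nontrivial_gns (hf : f 1 = 1) : Nontrivial f.GNS :=
  ⟨f.gnsVector, 0, fun h0 ↦ by
    have hv := norm_gnsVector hf
    rw [h0, norm_zero] at hv
    exact zero_ne_one hv⟩

variable {f} in
theorem re_apply_star_mul_self_le (hf : f 1 = 1) (a : A) :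
    (f (star a * a)).re ≤ ‖f.gnsStarAlgHom a‖ ^ 2 := by
  rw [← f.norm_gnsStarAlgHom_gnsVector_sq, Complex.ofReal_re]
  refine pow_le_pow_left₀ (norm_nonneg _) ?_ 2
  have h1 := (f.gnsStarAlgHom a).le_opNorm f.gnsVector
  rwa [norm_gnsVector hf, mul_one] at h1

/-- The hypothesis says that the GNS operator of `a` kills the class of every `x`, and these classes
are dense. -/
theorem gnsStarAlgHom_eq_zero {a : A} (h : ∀ x, f (star (a * x) * (a * x)) = 0) :
    f.gnsStarAlgHom a = 0 := by
  ext v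
  induction v using UniformSpace.Completion.induction_on with
  | hp => apply isClosed_eq <;> fun_prop
  | ih v =>
    change f.gnsNonUnitalStarAlgHom a _ = 0
    rw [gnsNonUnitalStarAlgHom_apply_coe, ← norm_eq_zero, UniformSpace.Completion.norm_coe,
      preGNS_norm_def]
    change √(f (star (a * f.ofPreGNS v) * (a * f.ofPreGNS v))).re = 0
    rw [h, Complex.zero_re, Real.sqrt_zero]

end PositiveLinearMap

/-! ### Ultrafilter limits of vector states -/

theorem Ultrafilter.exists_tendsto_of_norm_le {ι E : Type*} [NormedAddCommGroup E] [ProperSpace E]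
    (U : Ultrafilter ι) {u : ι → E} {C : ℝ} (hu : ∀ i, ‖u i‖ ≤ C) : ∃ l, Tendsto u U (𝓝 l) := by
  obtain ⟨l, _, hl⟩ := (isCompact_closedBall (0 : E) C).ultrafilter_le_nhds (U.map u)
    (le_principal_iff.mpr <| mem_map.mpr <| Eventually.of_forall fun i ↦
      mem_closedBall_zero_iff.mpr (hu i))
  exact ⟨l, hl⟩

/-- The vector states of a family of unit vectors converge along an ultrafilter. -/
theorem StarAlgHom.exists_positiveLinearMap_tendsto_inner {A ι H : Type*} [CStarAlgebra A]
    [PartialOrder A] [StarOrderedRing A] [NormedAddCommGroup H] [InnerProductSpace ℂ H]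
    [CompleteSpace H] (θ : A →⋆ₐ[ℂ] (H →L[ℂ] H)) (U : Ultrafilter ι) {ξ : ι → H}
    (hξ : ∀ i, ‖ξ i‖ = 1) :
    ∃ f : A →ₚ[ℂ] ℂ, ∀ y, Tendsto (fun i ↦ inner ℂ (ξ i) (θ y (ξ i))) U (𝓝 (f y)) := by
  have hlim : ∀ y, ∃ l, Tendsto (fun i ↦ inner ℂ (ξ i) (θ y (ξ i))) U (𝓝 l) := fun y ↦ by
    refine U.exists_tendsto_of_norm_le (C := ‖θ y‖) fun i ↦ ?_
    refine (norm_inner_le_norm _ _).trans ?_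
    rw [hξ, one_mul]
    simpa [hξ] using (θ y).le_opNorm (ξ i)
  choose φ hφ using hlim
  let F : A →ₗ[ℂ] ℂ :=
    { toFun := φ
      map_add' := fun x y ↦ tendsto_nhds_unique (hφ (x + y)) <|
        ((hφ x).add (hφ y)).congr fun i ↦ by simp
      map_smul' := fun c x ↦ tendsto_nhds_unique (hφ (c • x)) <|
        ((hφ x).const_mul c).congr fun i ↦ by simp }
  refine ⟨PositiveLinearMap.mk₀ F fun x hx ↦ ?_, hφ⟩
  obtain ⟨y, rfl⟩ := CStarAlgebra.nonneg_iff_eq_star_mul_self.mp hx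
  refine ge_of_tendsto' (hφ (star y * y)) fun i ↦ ?_
  rw [map_mul, map_star, ContinuousLinearMap.mul_def,
    ContinuousLinearMap.comp_apply, ContinuousLinearMap.star_eq_adjoint,
    ContinuousLinearMap.adjoint_inner_right]
  rw [inner_self_eq_norm_sq_to_K, ← RCLike.ofReal_pow]
  exact Complex.zero_le_real.mpr (sq_nonneg ‖θ y (ξ i)‖)

/-! ### Weighted creation operators and the vacuum projection -/

namespace FockModel

variable {n : ℕ}

/-- The canonical Hilbert basis of the full Fock space. -/
noncomputable def fockHilbertBasis (n : ℕ) : HilbertBasis (FreeMonoid (Fin n)) ℂ (Fock n) :=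
  HilbertBasis.ofRepr (LinearIsometryEquiv.refl ℂ _)

theorem fockHilbertBasis_apply (α : FreeMonoid (Fin n)) :
    fockHilbertBasis n α = fockBasis α := by
  rw [← (fockHilbertBasis n).repr_symm_single α]
  rfl

theorem inner_fockBasis_left (α : FreeMonoid (Fin n)) (x : Fock n) :
    inner ℂ (fockBasis α) x = x α := by
  simp [fockBasis, lp.inner_single_left]

theorem inner_fockBasis (α β : FreeMonoid (Fin n)) :
    inner ℂ (fockBasis α) (fockBasis β) = if α = β then (1 : ℂ) else 0 :=
  orthonormal_iff_ite.mp (orthonormal_fockBasis n) α β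

theorem fock_ext {S T : Fock n →L[ℂ] Fock n} (h : ∀ γ, S (fockBasis γ) = T (fockBasis γ)) :
    S = T := by
  refine ContinuousLinearMap.ext_on (s := Set.range (fockHilbertBasis n)) ?_ ?_
  · exact Submodule.dense_iff_topologicalClosure_eq_top.mpr (fockHilbertBasis n).dense_span
  · rintro _ ⟨γ, rfl⟩
    rw [fockHilbertBasis_apply]
    exact h γ

namespace Weights

variable (g : Weights n)

theorem word_W_fockBasis (α β : FreeMonoid (Fin n)) :
    word g.W α (fockBasis β) = (√(g.b β / g.b (α * β)) : ℂ) • fockBasis (α * β) := by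
  induction α using FreeMonoid.inductionOn' with
  | one => simp [word, (g.pos β).ne']
  | of_mul i α ih =>
    have h : word g.W (FreeMonoid.of i * α) = g.W i * word g.W α := by simp [word]
    rw [h, ContinuousLinearMap.mul_def, ContinuousLinearMap.comp_apply, ih, map_smul,
      W_fockBasis, smul_smul, mul_assoc,
      ← Complex.ofReal_mul, ← Real.sqrt_mul (div_pos (g.pos _) (g.pos _)).le,
      div_mul_div_cancel₀ (g.pos _).ne']

theorem star_word_W_fockBasis_mul (α β : FreeMonoid (Fin n)) :
    star (word g.W α) (fockBasis (α * β)) = (√(g.b β / g.b (α * β)) : ℂ) • fockBasis β := by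
  ext δ
  rw [← inner_fockBasis_left, ← inner_fockBasis_left, ContinuousLinearMap.star_eq_adjoint,
    ContinuousLinearMap.adjoint_inner_right, word_W_fockBasis, inner_smul_left, inner_smul_right,
    inner_fockBasis, inner_fockBasis]
  by_cases h : δ = β
  · simp [h]
  · simp [h]

theorem star_word_W_fockBasis_eq_zero {α γ : FreeMonoid (Fin n)} (h : ∀ β, γ ≠ α * β) :
    star (word g.W α) (fockBasis γ) = 0 := by
  ext δ
  rw [← inner_fockBasis_left, ContinuousLinearMap.star_eq_adjoint,
    ContinuousLinearMap.adjoint_inner_right, word_W_fockBasis, inner_smul_left,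
    inner_fockBasis, if_neg (h δ).symm]
  simp

theorem word_W_mul_star_fockBasis_mul (α β : FreeMonoid (Fin n)) :
    (word g.W α * star (word g.W α)) (fockBasis (α * β)) =
      ((g.b β / g.b (α * β) : ℝ) : ℂ) • fockBasis (α * β) := by
  rw [ContinuousLinearMap.mul_def, ContinuousLinearMap.comp_apply, star_word_W_fockBasis_mul,
    map_smul, word_W_fockBasis,
    smul_smul, ← Complex.ofReal_mul, Real.mul_self_sqrt (div_pos (g.pos _) (g.pos _)).le]

theorem word_W_mul_star_fockBasis_eq_zero {α γ : FreeMonoid (Fin n)} (h : ∀ β, γ ≠ α * β) :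
    (word g.W α * star (word g.W α)) (fockBasis γ) = 0 := by
  rw [ContinuousLinearMap.mul_def, ContinuousLinearMap.comp_apply,
    star_word_W_fockBasis_eq_zero g h, map_zero]

/-- Each `W_α W_α^*` is diagonal and annihilates `e_γ` unless `α` is a prefix of `γ`; there is
exactly one prefix of length `k`. -/
theorem sum_word_W_fockBasis (γ : FreeMonoid (Fin n)) {k : ℕ} (hk : k ≤ γ.length) :
    ∑ w : Fin k → Fin n, (g.a (FreeMonoid.ofList (List.ofFn w)) : ℂ) •
      (word g.W (FreeMonoid.ofList (List.ofFn w)) *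
        star (word g.W (FreeMonoid.ofList (List.ofFn w)))) (fockBasis γ) =
      ((g.a (FreeMonoid.ofList (γ.toList.take k)) * g.b (FreeMonoid.ofList (γ.toList.drop k)) /
        g.b γ : ℝ) : ℂ) • fockBasis γ := by
  have hk' : k ≤ γ.toList.length := hk
  have hγ : γ = FreeMonoid.ofList (γ.toList.take k) * FreeMonoid.ofList (γ.toList.drop k) := by
    rw [← FreeMonoid.ofList_append, List.take_append_drop, FreeMonoid.ofList_toList]
  let w₀ : Fin k → Fin n := fun j ↦ γ.toList[j]'(j.2.trans_le hk')
  have hw₀ : List.ofFn w₀ = γ.toList.take k := by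
    apply List.ext_getElem
    · simp [hk']
    · intro i h1 h2
      simp [w₀]
  rw [Finset.sum_eq_single w₀]
  · rw [hw₀]
    have h := g.word_W_mul_star_fockBasis_mul (FreeMonoid.ofList (γ.toList.take k))
      (FreeMonoid.ofList (γ.toList.drop k))
    rw [← hγ] at h
    rw [h, smul_smul, ← Complex.ofReal_mul, mul_div_assoc]
  · intro w _ hw
    rw [word_W_mul_star_fockBasis_eq_zero, smul_zero]
    rintro β rfl
    apply hw
    apply List.ofFn_injective
    rw [hw₀, FreeMonoid.toList_mul, FreeMonoid.toList_ofList, List.take_left' (by simp)]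
  · simp

theorem sum_word_W_fockBasis_of_lt (γ : FreeMonoid (Fin n)) {k : ℕ} (hk : γ.length < k) :
    ∑ w : Fin k → Fin n, (g.a (FreeMonoid.ofList (List.ofFn w)) : ℂ) •
      (word g.W (FreeMonoid.ofList (List.ofFn w)) *
        star (word g.W (FreeMonoid.ofList (List.ofFn w)))) (fockBasis γ) = 0 := by
  refine Finset.sum_eq_zero fun w _ ↦ ?_
  rw [word_W_mul_star_fockBasis_eq_zero, smul_zero]
  rintro β rfl
  have : (FreeMonoid.ofList (List.ofFn w)).length = k := by simp [FreeMonoid.length]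
  rw [FreeMonoid.length_mul] at hk
  omega

/-- Adding the contributions of all prefixes gives the Cauchy product of `g⁻¹` and `g` at `γ`,
divided by `b_γ`. The lengths in the partial sum are those below `N`, so strict inequality is what
includes `γ` itself. -/
theorem deltaSum_fockBasis (γ : FreeMonoid (Fin n)) {N : ℕ} (hN : γ.length < N) :
    deltaSum g.a g.W N (fockBasis γ) = rankOne ℂ (fockBasis 1) (fockBasis 1) (fockBasis γ) := by
  have h1 : deltaSum g.a g.W N (fockBasis γ) = ∑ k ∈ Finset.range N,
      ∑ w : Fin k → Fin n, (g.a (FreeMonoid.ofList (List.ofFn w)) : ℂ) •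
      (word g.W (FreeMonoid.ofList (List.ofFn w)) *
        star (word g.W (FreeMonoid.ofList (List.ofFn w)))) (fockBasis γ) := by
    simp only [deltaSum, gradedSum, sum_apply, smul_apply]
  have hsub : Finset.range (γ.length + 1) ⊆ Finset.range N := Finset.range_subset_range.mpr hN
  rw [h1, ← Finset.sum_subset hsub fun k _ hk ↦ g.sum_word_W_fockBasis_of_lt γ (by
    simpa [Nat.lt_succ_iff] using hk)]
  rw [Finset.sum_congr rfl fun k hk ↦ g.sum_word_W_fockBasis γ
    (Nat.lt_succ_iff.mp (Finset.mem_range.mp hk)), ← Finset.sum_smul, ← Complex.ofReal_sum,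
    ← Finset.sum_div]
  have h2 := congrFun (seriesMul_seriesInv_left g.b g.one) γ
  rw [seriesMul] at h2
  rw [a, h2, rankOne_apply, inner_fockBasis, seriesOne]
  by_cases hγ : γ = 1
  · simp [hγ, g.one]
  · simp [hγ, Ne.symm hγ, FreeMonoid.length_eq_zero]

/-- The only possible limit of `∑ a_α W_α W_α^*` is the projection onto the vacuum vector. -/
theorem eq_rankOne_of_tendsto_deltaSum {D : Fock n →L[ℂ] Fock n}
    (hD : Tendsto (deltaSum g.a g.W) atTop (𝓝 D)) : D = rankOne ℂ (fockBasis 1) (fockBasis 1) := by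
  refine fock_ext fun γ ↦ ?_
  have h : Tendsto (fun N ↦ deltaSum g.a g.W N (fockBasis γ)) atTop (𝓝 (D (fockBasis γ))) :=
    ((ContinuousLinearMap.apply ℂ (Fock n) (fockBasis γ)).continuous.tendsto D).comp hD
  refine tendsto_nhds_unique h (tendsto_const_nhds.congr' ?_)
  filter_upwards [eventually_gt_atTop γ.length] with N hN
  exact (g.deltaSum_fockBasis γ hN).symm

/-- Since `W_α e_1 = √(1 / b_α) e_α`, compressing the vacuum projection between `W_α` and `W_β^*`
yields a matrix unit up to a nonzero scalar. -/
theorem rankOne_fockBasis (α β : FreeMonoid (Fin n)) :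
    rankOne ℂ (fockBasis α) (fockBasis β) = ((√(1 / g.b α) * √(1 / g.b β) : ℝ) : ℂ)⁻¹ •
      (word g.W α * rankOne ℂ (fockBasis 1) (fockBasis 1) * star (word g.W β)) := by
  have h : word g.W α * rankOne ℂ (fockBasis 1) (fockBasis 1) * star (word g.W β) =
      rankOne ℂ (word g.W α (fockBasis 1)) (word g.W β (fockBasis 1)) := by
    rw [ContinuousLinearMap.mul_def, ContinuousLinearMap.mul_def, comp_rankOne, rankOne_comp,
      ContinuousLinearMap.star_eq_adjoint, ContinuousLinearMap.adjoint_adjoint]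
  have hα : (√(1 / g.b α) : ℂ) ≠ 0 :=
    Complex.ofReal_ne_zero.mpr (Real.sqrt_pos.mpr (one_div_pos.mpr (g.pos α))).ne'
  have hβ : (√(1 / g.b β) : ℂ) ≠ 0 :=
    Complex.ofReal_ne_zero.mpr (Real.sqrt_pos.mpr (one_div_pos.mpr (g.pos β))).ne'
  rw [h, word_W_fockBasis, word_W_fockBasis, mul_one, mul_one, g.one]
  ext1 x
  simp only [rankOne_apply, smul_apply, inner_smul_left, smul_smul,
    Complex.conj_ofReal, Complex.ofReal_mul]
  congr 1
  field_simp

end Weights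
end FockModel

/-! ### The homomorphism from `C*(W)` to `𝒪(g)` -/

namespace FockModel

variable {n : ℕ}

theorem continuous_starAlgHom {A B : Type*} [CStarAlgebra A] [CStarAlgebra B] (π : A →⋆ₐ[ℂ] B) :
    Continuous π :=
  AddMonoidHomClass.continuous_of_bound π 1 fun x ↦ by
    simpa using NonUnitalStarAlgHom.norm_apply_le π x

/-- A point of the closure is a rapidly converging series of elements of the range; lifts of
controlled norm form a convergent series in the complete algebra `A`. -/
theorem isClosed_range_of_exists_norm_le {A B : Type*} [CStarAlgebra A] [CStarAlgebra B]
    (σ : A →⋆ₐ[ℂ] B) {C : ℝ} (hC : 0 < C) (h : ∀ x, ∃ y, σ y = σ x ∧ ‖y‖ ≤ C * ‖σ x‖) :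
    IsClosed (σ.range : Set B) := by
  let f : NormedAddGroupHom A B := (σ : A →+ B).mkNormedAddGroupHom 1 fun x ↦ by
    simpa using NonUnitalStarAlgHom.norm_apply_le σ x
  have hf : f.SurjectiveOnWith f.range C := by
    rintro _ ⟨x, rfl⟩
    exact h x
  have hf' := controlled_closure_of_complete hC one_pos hf
  have hrange : (σ.range : Set B) = f.range := rfl
  rw [hrange]
  refine isClosed_of_closure_subset fun y hy ↦ ?_
  obtain ⟨x, hx, -⟩ := hf' y hy
  exact ⟨x, hx⟩

theorem map_word {A B : Type*} [Semiring A] [Algebra ℂ A] [Star A] [Semiring B]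
    [Algebra ℂ B] [Star B]
    (π : A →⋆ₐ[ℂ] B) (X : Fin n → A) (α : FreeMonoid (Fin n)) :
    π (word X α) = word (fun i ↦ π (X i)) α := by
  induction α using FreeMonoid.inductionOn' with
  | one => simp [word]
  | of_mul i α ih => simpa [word] using congrArg (π (X i) * ·) ih

theorem map_deltaSum {A B : Type*} [Ring A] [Algebra ℂ A] [StarRing A] [Ring B] [Algebra ℂ B]
    [StarRing B] (π : A →⋆ₐ[ℂ] B) (c : FreeMonoid (Fin n) → ℝ) (X : Fin n → A) (N : ℕ) :
    π (deltaSum c X N) = deltaSum c (fun i ↦ π (X i)) N := by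
  simp only [deltaSum, gradedSum, map_sum, map_smul, map_mul, map_star, map_word]

namespace Weights

variable (g : Weights n)

theorem coe_deltaSum_genW (N : ℕ) :
    ((deltaSum g.a g.genW N : g.cstarW) : Fock n →L[ℂ] Fock n) = deltaSum g.a g.W N :=
  map_deltaSum g.cstarW.subtype g.a g.genW N

/-- The diagonal representation of `C*(W)` in the product over all Cuntz type representations. -/
noncomputable def cuntzDiagonal : g.cstarW →⋆ₐ[ℂ] g.CuntzProduct where
  toFun x := ⟨fun ω ↦ ω.π x, memℓp_infty ⟨‖x‖, by
    rintro _ ⟨ω, rfl⟩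
    exact NonUnitalStarAlgHom.norm_apply_le ω.π x⟩⟩
  map_one' := by ext1; funext ω; simp
  map_mul' x y := by ext1; funext ω; simp
  map_zero' := by ext1; funext ω; simp
  map_add' x y := by ext1; funext ω; exact map_add ω.π x y
  commutes' r := by ext1; funext ω; exact AlgHomClass.commutes ω.π r
  map_star' x := by ext1; funext ω; exact map_star ω.π x

theorem cuntzDiagonal_mem (x : g.cstarW) : g.cuntzDiagonal x ∈ g.cuntzAlgebra := by
  -- The preimage is pushed forward to operators on Fock space, where `C*(W)` is the smallest closed
  -- star subalgebra containing the `W_i`.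
  have hclosed : IsClosed ((g.cuntzAlgebra.comap g.cuntzDiagonal).map g.cstarW.subtype :
      Set (Fock n →L[ℂ] Fock n)) := by
    rw [StarSubalgebra.coe_map]
    refine (IsClosed.isClosedEmbedding_subtypeVal
      (inferInstance : IsClosed (g.cstarW : Set (Fock n →L[ℂ] Fock n)))).isClosedMap _ ?_
    exact (inferInstance : IsClosed (g.cuntzAlgebra : Set g.CuntzProduct)).preimage
      (continuous_starAlgHom g.cuntzDiagonal)
  have hle : g.cstarW ≤ (g.cuntzAlgebra.comap g.cuntzDiagonal).map g.cstarW.subtype := by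
    refine StarSubalgebra.topologicalClosure_minimal (StarAlgebra.adjoin_le ?_) hclosed
    rintro _ ⟨i, rfl⟩
    exact ⟨g.genW i, (g.cuntzGen i).2, rfl⟩
  obtain ⟨y, hy, hyx⟩ := hle x.2
  rwa [Subtype.ext hyx] at hy

/-- The canonical `*`-homomorphism `C*(W) → 𝒪(g)`. -/
noncomputable def toCuntzAlgebra : g.cstarW →⋆ₐ[ℂ] g.cuntzAlgebra :=
  StarAlgHom.codRestrict g.cuntzDiagonal g.cuntzAlgebra g.cuntzDiagonal_mem

/-- The series `∑ a_α W_α W_α^*` converges in norm to the projection onto the vacuum vector. -/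
def TendstoVacuumProj (g : Weights n) : Prop :=
  Tendsto (deltaSum g.a g.W) atTop (𝓝 (rankOne ℂ (fockBasis 1) (fockBasis 1)))

theorem vacuumProj_mem (hP : g.TendstoVacuumProj) :
    rankOne ℂ (fockBasis 1) (fockBasis 1) ∈ g.cstarW := by
  refine (inferInstance : IsClosed (g.cstarW : Set (Fock n →L[ℂ] Fock n))).mem_of_tendsto hP
    (Eventually.of_forall fun N ↦ ?_)
  rw [← coe_deltaSum_genW]
  exact (deltaSum g.a g.genW N).2

/-- Norm convergence survives every `*`-homomorphism, so the weak limit in the definition of Cuntz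
type is the image of the vacuum projection: Cuntz type means that this image is zero. -/
theorem tendsto_deltaSum_map (hP : g.TendstoVacuumProj) {B : Type*} [CStarAlgebra B]
    (π : g.cstarW →⋆ₐ[ℂ] B) :
    Tendsto (deltaSum g.a fun i ↦ π (g.genW i)) atTop (𝓝 (π ⟨_, g.vacuumProj_mem hP⟩)) := by
  have h : Tendsto (deltaSum g.a g.genW) atTop (𝓝 ⟨_, g.vacuumProj_mem hP⟩) := by
    rw [tendsto_subtype_rng]
    exact hP.congr fun N ↦ (g.coe_deltaSum_genW N).symm
  exact (((continuous_starAlgHom π).tendsto _).comp h).congr fun N ↦ map_deltaSum π g.a g.genW N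

theorem isCuntzType_of_map_vacuumProj (hP : g.TendstoVacuumProj) {K : Type*}
    [NormedAddCommGroup K] [InnerProductSpace ℂ K] [CompleteSpace K]
    (π : g.cstarW →⋆ₐ[ℂ] (K →L[ℂ] K)) (hπ : π ⟨_, g.vacuumProj_mem hP⟩ = 0) :
    g.IsCuntzType π := by
  intro ξ η
  have h := g.tendsto_deltaSum_map hP π
  rw [hπ] at h
  have h2 := (((ContinuousLinearMap.apply ℂ K η).continuous.tendsto _).comp h)
  simpa using (tendsto_const_nhds (x := ξ)).inner h2

theorem map_vacuumProj_of_cuntzRep (hP : g.TendstoVacuumProj) (ω : g.CuntzRep) :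
    ω.π ⟨_, g.vacuumProj_mem hP⟩ = 0 := by
  ext η
  refine ext_inner_left ℂ fun ξ ↦ ?_
  have h := (((ContinuousLinearMap.apply ℂ ω.K η).continuous.tendsto _).comp
    (g.tendsto_deltaSum_map hP ω.π))
  simpa using tendsto_nhds_unique ((tendsto_const_nhds (x := ξ)).inner h) (ω.isCuntzType ξ η)

/-- Compact operators belong to `C*(W)`, and every Cuntz type representation annihilates them. -/
theorem exists_mem_cuntzDiagonal_eq_zero (hP : g.TendstoVacuumProj) {T : Fock n →L[ℂ] Fock n}
    (hT : IsCompactOperator T) :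
    ∃ h : T ∈ g.cstarW, g.cuntzDiagonal ⟨T, h⟩ = 0 := by
  -- The kernel, viewed inside all operators on Fock space, is a closed subspace, so checking matrix
  -- units gives both membership in `C*(W)` and vanishing.
  let I : Submodule ℂ (Fock n →L[ℂ] Fock n) :=
    (LinearMap.ker g.cuntzDiagonal.toAlgHom.toLinearMap).map
      g.cstarW.toSubalgebra.toSubmodule.subtype
  have hI : IsClosed (I : Set (Fock n →L[ℂ] Fock n)) := by
    refine (IsClosed.isClosedEmbedding_subtypeVal
      (inferInstance : IsClosed (g.cstarW : Set (Fock n →L[ℂ] Fock n)))).isClosedMap _ ?_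
    exact isClosed_singleton.preimage (continuous_starAlgHom g.cuntzDiagonal)
  have hb : ∀ α β, rankOne ℂ (fockHilbertBasis n α) (fockHilbertBasis n β) ∈ I := by
    intro α β
    rw [fockHilbertBasis_apply, fockHilbertBasis_apply, g.rankOne_fockBasis]
    refine I.smul_mem _ ⟨word g.genW α * ⟨_, g.vacuumProj_mem hP⟩ * star (word g.genW β), ?_, ?_⟩
    · have h0 : g.cuntzDiagonal ⟨_, g.vacuumProj_mem hP⟩ = 0 := by
        ext1
        funext ω
        exact g.map_vacuumProj_of_cuntzRep hP ω
      change g.cuntzDiagonal _ = 0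
      rw [map_mul, map_mul, h0, mul_zero, zero_mul]
    · have hw : ∀ γ, ((word g.genW γ : g.cstarW) : Fock n →L[ℂ] Fock n) = word g.W γ :=
        map_word g.cstarW.subtype g.genW
      rw [← hw, ← hw]
      rfl
  obtain ⟨x, hx, rfl⟩ := (fockHilbertBasis n).mem_of_isCompactOperator hI hb hT
  exact ⟨x.2, hx⟩

/-! ### Detecting the distance to truncations by Cuntz type representations -/

/-- A state of `C*(W)` that vanishes on the compact operators and is large at `x^* x`, if `x` stays
far from its truncations. -/
theorem exists_state_le_apply [PartialOrder g.cstarW] [StarOrderedRing g.cstarW] {x : g.cstarW}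
    {c : ℝ} (hc : 0 ≤ c)
    (h : ∀ J, c < ‖(x : Fock n →L[ℂ] Fock n) - x ∘L (fockHilbertBasis n).coordProj J‖) :
    ∃ f : g.cstarW →ₚ[ℂ] ℂ, f 1 = 1 ∧ c ^ 2 ≤ (f (star x * x)).re ∧
      ∀ y : g.cstarW, IsCompactOperator (y : Fock n →L[ℂ] Fock n) → f (star y * y) = 0 := by
  choose ξ hξ hξP hξc using
    fun J ↦ (fockHilbertBasis n).exists_unit_vector_of_lt_norm_sub hc (h J)
  let U : Ultrafilter (Finset (FreeMonoid (Fin n))) := Ultrafilter.of atTop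
  obtain ⟨f, hf⟩ := g.cstarW.subtype.exists_positiveLinearMap_tendsto_inner U hξ
  have hfsq : ∀ y : g.cstarW, Tendsto (fun J ↦ ((‖(y : Fock n →L[ℂ] Fock n) (ξ J)‖ ^ 2 : ℝ) : ℂ))
      U (𝓝 (f (star y * y))) := by
    intro y
    refine (hf (star y * y)).congr fun J ↦ ?_
    change inner ℂ (ξ J) (star (y : Fock n →L[ℂ] Fock n) ((y : Fock n →L[ℂ] Fock n) (ξ J))) = _
    rw [ContinuousLinearMap.star_eq_adjoint, ContinuousLinearMap.adjoint_inner_right,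
      inner_self_eq_norm_sq_to_K, Complex.ofReal_pow]
    rfl
  refine ⟨f, ?_, ?_, fun y hy ↦ ?_⟩
  · refine tendsto_nhds_unique (hf 1) (tendsto_const_nhds.congr fun J ↦ ?_)
    simp [hξ]
  · refine ge_of_tendsto' ((Complex.continuous_re.tendsto _).comp (hfsq x)) fun J ↦ ?_
    rw [Function.comp_apply, Complex.ofReal_re]
    exact pow_le_pow_left₀ hc (hξc J) 2
  · refine tendsto_nhds_unique (hfsq y) ?_
    -- As `P_J ξ_J = 0`, the vector `y ξ_J` equals `(y - y P_J) ξ_J`, and `y - y P_J` tends to zero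
    -- in norm for compact `y`.
    have h0 : Tendsto (fun J ↦ ‖(y : Fock n →L[ℂ] Fock n) (ξ J)‖) U (𝓝 0) := by
      refine squeeze_zero (fun _ ↦ norm_nonneg _) (fun J ↦ ?_)
        (((fockHilbertBasis n).tendsto_norm_sub_comp_coordProj hy).mono_left
          (Ultrafilter.of_le atTop))
      have h1 := ((y : Fock n →L[ℂ] Fock n) -
        y ∘L (fockHilbertBasis n).coordProj J).le_opNorm (ξ J)
      simpa [hξP, hξ] using h1
    have h2 := (Complex.continuous_ofReal.tendsto _).comp (h0.pow 2)
    rwa [zero_pow two_ne_zero, Complex.ofReal_zero] at h2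

theorem exists_cuntzRep_norm_eq {g : Weights n} {K : Type} [NormedAddCommGroup K]
    [InnerProductSpace ℂ K] [CompleteSpace K] (π : g.cstarW →⋆ₐ[ℂ] (K →L[ℂ] K))
    (hK : Nontrivial K) (hπ : g.IsCuntzType π) : ∃ ω : g.CuntzRep, ∀ x, ‖ω.π x‖ = ‖π x‖ :=
  ⟨⟨K, π, hπ⟩, fun _ ↦ rfl⟩

theorem isCompactOperator_vacuumProj_comp (T : Fock n →L[ℂ] Fock n) :
    IsCompactOperator (rankOne ℂ (fockBasis 1) (fockBasis 1) * T : Fock n →L[ℂ] Fock n) :=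
  (isCompactOperator_rankOne (fockBasis 1 : Fock n) (fockBasis 1)).comp_clm T

/-- The GNS representation of a state that vanishes on the compact operators is of Cuntz type. -/
theorem exists_cuntzRep_of_state (hP : g.TendstoVacuumProj) [PartialOrder g.cstarW]
    [StarOrderedRing g.cstarW] {f : g.cstarW →ₚ[ℂ] ℂ} (hf1 : f 1 = 1)
    (hf : ∀ y : g.cstarW, IsCompactOperator (y : Fock n →L[ℂ] Fock n) → f (star y * y) = 0)
    (x : g.cstarW) : ∃ ω : g.CuntzRep, (f (star x * x)).re ≤ ‖ω.π x‖ ^ 2 := by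
  -- The product of the vacuum projection with any `y` is compact, so the state vanishes at the
  -- corresponding square.
  have hzero : f.gnsStarAlgHom ⟨_, g.vacuumProj_mem hP⟩ = 0 :=
    f.gnsStarAlgHom_eq_zero fun y ↦ hf _ (isCompactOperator_vacuumProj_comp _)
  obtain ⟨ω, hω⟩ := exists_cuntzRep_norm_eq f.gnsStarAlgHom
    (PositiveLinearMap.nontrivial_gns hf1) (g.isCuntzType_of_map_vacuumProj hP _ hzero)
  exact ⟨ω, hω x ▸ PositiveLinearMap.re_apply_star_mul_self_le hf1 x⟩

/-- If the distance of `x` to its truncations exceeds `c`, then some Cuntz type representation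
maps `x` to an operator of norm at least `c`. -/
theorem exists_cuntzRep_le_norm (hP : g.TendstoVacuumProj) {x : g.cstarW} {c : ℝ} (hc : 0 ≤ c)
    (h : ∀ J, c < ‖(x : Fock n →L[ℂ] Fock n) - x ∘L (fockHilbertBasis n).coordProj J‖) :
    ∃ ω : g.CuntzRep, c ≤ ‖ω.π x‖ := by
  let := CStarAlgebra.spectralOrder g.cstarW
  have := CStarAlgebra.spectralOrderedRing g.cstarW
  obtain ⟨f, hf1, hfx, hf⟩ := g.exists_state_le_apply hc h
  obtain ⟨ω, hω⟩ := g.exists_cuntzRep_of_state hP hf1 hf x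
  exact ⟨ω, (pow_le_pow_iff_left₀ hc (norm_nonneg _) two_ne_zero).mp (hfx.trans hω)⟩

/-- A single Cuntz type representation giving `x` norm at least `c` would already contradict `‖σ x‖
< c`. -/
theorem exists_norm_sub_comp_coordProj_le (hP : g.TendstoVacuumProj) (x : g.cstarW) {c : ℝ}
    (hc : ‖g.cuntzDiagonal x‖ < c) :
    ∃ J, ‖(x : Fock n →L[ℂ] Fock n) - x ∘L (fockHilbertBasis n).coordProj J‖ ≤ c := by
  by_contra! h
  obtain ⟨ω, hω⟩ := g.exists_cuntzRep_le_norm hP ((norm_nonneg _).trans hc.le) h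
  refine (hω.trans ?_).not_gt hc
  exact lp.norm_apply_le_norm ENNReal.top_ne_zero (g.cuntzDiagonal x) ω

theorem cuntzDiagonal_eq_zero_iff (hP : g.TendstoVacuumProj) (x : g.cstarW) :
    g.cuntzDiagonal x = 0 ↔ IsCompactOperator (x : Fock n →L[ℂ] Fock n) := by
  refine ⟨fun hx ↦ ?_, fun hx ↦ (g.exists_mem_cuntzDiagonal_eq_zero hP hx).2⟩
  refine (fockHilbertBasis n).isCompactOperator_of_norm_sub_comp_coordProj_le fun ε hε ↦ ?_
  exact g.exists_norm_sub_comp_coordProj_le hP x (by simpa [hx] using hε)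

theorem isClosed_range_cuntzDiagonal (hP : g.TendstoVacuumProj) :
    IsClosed (g.cuntzDiagonal.range : Set g.CuntzProduct) := by
  refine isClosed_range_of_exists_norm_le g.cuntzDiagonal two_pos fun x ↦ ?_
  rcases (norm_nonneg (g.cuntzDiagonal x)).eq_or_lt' with hx | hx
  · exact ⟨0, by rw [map_zero, norm_eq_zero.mp hx], by rw [norm_zero, hx, mul_zero]⟩
  -- The estimate needs a bound strictly above `‖σ x‖`; the factor 2 provides it once `σ x ≠ 0`, and
  -- any factor above 1 would do. The truncation is compact, so subtracting it does not change the
  -- image.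
  · obtain ⟨J, hJ⟩ := g.exists_norm_sub_comp_coordProj_le hP x
      (c := 2 * ‖g.cuntzDiagonal x‖) (by linarith)
    obtain ⟨hk, hk0⟩ := g.exists_mem_cuntzDiagonal_eq_zero hP
      ((fockHilbertBasis n).isCompactOperator_comp_coordProj (x : Fock n →L[ℂ] Fock n) J)
    let k : g.cstarW := ⟨(x : Fock n →L[ℂ] Fock n) ∘L (fockHilbertBasis n).coordProj J, hk⟩
    refine ⟨x - k, ?_, hJ⟩
    rw [map_sub, hk0, sub_zero]

theorem toCuntzAlgebra_surjective (hP : g.TendstoVacuumProj) :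
    Function.Surjective g.toCuntzAlgebra := by
  have hle : g.cuntzAlgebra ≤ g.cuntzDiagonal.range := by
    refine StarSubalgebra.topologicalClosure_minimal (StarAlgebra.adjoin_le ?_)
      (g.isClosed_range_cuntzDiagonal hP)
    rintro _ ⟨i, rfl⟩
    exact ⟨g.genW i, rfl⟩
  intro y
  obtain ⟨x, hx⟩ := hle y.2
  exact ⟨x, Subtype.ext hx⟩

end Weights
end FockModel

/-! ### Exactness of the sequence -/

theorem mainTheorem3 (n : ℕ) (g : Weights n) (hg : g.IsAdmissible)
    (hconv : ∃ D : Fock n →L[ℂ] Fock n, Tendsto (deltaSum g.a g.W) atTop (𝓝 D)) :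
    ∃ (ι : compactOps (Fock n) →⋆ₙₐ[ℂ] g.cstarW) (ρ : g.cstarW →⋆ₐ[ℂ] g.cuntzAlgebra),
      (∀ T : compactOps (Fock n), (ι T : Fock n →L[ℂ] Fock n) = T) ∧
      (∀ i, ρ (g.genW i) = g.cuntzGen i) ∧
      Function.Injective ι ∧ Function.Exact ι ρ ∧ Function.Surjective ρ := by
  obtain ⟨D, hD⟩ := hconv
  have hP : g.TendstoVacuumProj := by
    rwa [g.eq_rankOne_of_tendsto_deltaSum hD] at hD
  let ι : compactOps (Fock n) →⋆ₙₐ[ℂ] g.cstarW :=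
    { toFun := fun T ↦ ⟨T, (g.exists_mem_cuntzDiagonal_eq_zero hP T.2).1⟩
      map_smul' := fun _ _ ↦ rfl
      map_zero' := rfl
      map_add' := fun _ _ ↦ rfl
      map_mul' := fun _ _ ↦ rfl
      map_star' := fun _ ↦ rfl }
  refine ⟨ι, g.toCuntzAlgebra, fun T ↦ rfl, fun i ↦ rfl, fun S T h ↦ ?_, fun x ↦ ?_,
    g.toCuntzAlgebra_surjective hP⟩
  · exact Subtype.ext (congrArg (Subtype.val : g.cstarW → _) h)
  · have h0 : g.toCuntzAlgebra x = 0 ↔ g.cuntzDiagonal x = 0 := Subtype.ext_iff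
    rw [h0, g.cuntzDiagonal_eq_zero_iff hP]
    exact ⟨fun hx ↦ ⟨⟨x, hx⟩, rfl⟩, by rintro ⟨T, rfl⟩; exact T.2⟩
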